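/- For a nonzero polynomial $P\in\mathbb{C}[x_1,\dots,x_n]$ let $$\mathrm{m}(P)=\frac{1}{(2\pi i)^n}\int_{\mathbb{T}^n}\log|P(x_1,\dots,x_n)|\,\frac{dx_1}{x_1}\cdots\frac{dx_n}{x_n},\qquad \mathbb{T}^n=\{(x_1,\dots,x_n)\in\mathbb{C}^n:|x_1|=\cdots=|x_n|=1\},$$ denote its (logarithmic) Mahler measure. For real $\alpha$ put $$P_\alpha(x,y)=(x+1)(y+1)(x+y)-\alpha xy,\qquad S_\alpha(x,y)=y^2+(x^4+\alpha x^3+2\alpha x^2+\alpha x+1)\,y+x^4.$$ Then, for every real $\alpha$, the integrals defining $\mathrm{m}(P_\alpha)$ and $\mathrm{m}(S_\alpha)$ converge absolutely, and $$\mathrm{m}(S_\alpha)=\begin{cases}2\,\mathrm{m}(P_\alpha) & \text{if } 0\le\alpha\le 4,\\ \mathrm{m}(P_\alpha) & \text{if } \alpha\le -1.\end{cases}$$ -/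

import Mathlib

namespace MahlerFamilies

open MvPolynomial

/-- The logarithmic Mahler measure
`m(P) = (2πi)⁻ⁿ ∫_{𝕋ⁿ} log |P(x₁, …, xₙ)| dx₁/x₁ ⋯ dxₙ/xₙ`
of a nonzero polynomial in `n` complex variables, written in the angular coordinates
`xⱼ = exp (i θⱼ)`, `0 ≤ θⱼ ≤ 2π`. (It is the contour integral on the unit torus by
`logMahler_eq_torusIntegral` below.) -/
noncomputable def logMahler {n : ℕ} (P : MvPolynomial (Fin n) ℂ) : ℝ :=
  ((2 * Real.pi) ^ n)⁻¹ *
    ∫ θ : Fin n → ℝ in Set.Icc (0 : Fin n → ℝ) (fun _ => 2 * Real.pi),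
      Real.log ‖eval (torusMap 0 1 θ) P‖

/-- The integral that defines the Mahler measure of `P` converges absolutely: `log |P|` is
integrable on the unit torus. -/
def LogIntegrable {n : ℕ} (P : MvPolynomial (Fin n) ℂ) : Prop :=
  TorusIntegrable (fun z : Fin n → ℂ => Real.log ‖eval z P‖) 0 1

/-- `logMahler` is the normalised contour integral of `log |P|` over the unit torus against
`dx₁/x₁ ⋯ dxₙ/xₙ`. -/
theorem logMahler_eq_torusIntegral {n : ℕ} (P : MvPolynomial (Fin n) ℂ) :
    (logMahler P : ℂ) = ((2 * Real.pi * Complex.I) ^ n)⁻¹ *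
      torusIntegral (fun z : Fin n → ℂ => (∏ i, z i)⁻¹ * (Real.log ‖eval z P‖ : ℂ)) 0 1 := by
  have h : ∀ θ : Fin n → ℝ,
      (∏ i, (((1 : Fin n → ℝ) i : ℝ) : ℂ) * Complex.exp (θ i * Complex.I) * Complex.I) •
        ((∏ i, torusMap 0 1 θ i)⁻¹ * (Real.log ‖eval (torusMap 0 1 θ) P‖ : ℂ))
      = Complex.I ^ n * (Real.log ‖eval (torusMap 0 1 θ) P‖ : ℂ) := by
    intro θ
    have h0 : (∏ i, Complex.exp (θ i * Complex.I)) ≠ 0 :=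
      Finset.prod_ne_zero_iff.mpr fun i _ => Complex.exp_ne_zero _
    simp only [smul_eq_mul, torusMap, Pi.one_apply, Pi.zero_apply, Complex.ofReal_one, one_mul,
      zero_add, Finset.prod_mul_distrib, Finset.prod_const, Finset.card_univ, Fintype.card_fin]
    rw [mul_comm _ (Complex.I ^ n), mul_assoc, mul_inv_cancel_left₀ h0]
  unfold logMahler torusIntegral
  simp_rw [h]
  rw [MeasureTheory.integral_const_mul, integral_complex_ofReal, mul_pow _ Complex.I]
  have hI : (Complex.I : ℂ) ^ n ≠ 0 := pow_ne_zero _ Complex.I_ne_zero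
  rw [mul_inv, mul_assoc, inv_mul_cancel_left₀ hI]
  push_cast
  rfl

/-- `P_α(x, y) = (x + 1)(y + 1)(x + y) - α x y`, with `x = X 0` and `y = X 1`. -/
noncomputable def polyP (α : ℝ) : MvPolynomial (Fin 2) ℂ :=
  (X 0 + 1) * (X 1 + 1) * (X 0 + X 1) - C (α : ℂ) * X 0 * X 1

/-- `S_α(x, y) = y² + (x⁴ + α x³ + 2 α x² + α x + 1) y + x⁴`, with `x = X 0` and `y = X 1`. -/
noncomputable def polyS (α : ℝ) : MvPolynomial (Fin 2) ℂ :=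
  X 1 ^ 2 + (X 0 ^ 4 + C (α : ℂ) * X 0 ^ 3 + 2 * C (α : ℂ) * X 0 ^ 2 + C (α : ℂ) * X 0 + 1) * X 1
    + X 0 ^ 4

end MahlerFamilies

/-!
Over a point `x` of the unit circle, `S_α(x, ·)` and `P_α(x, ·)` are, up to a nonzero factor and
a rotation of `y`, of the form `y² + B y + 1` with `B` real and affine in `α`. The Mahler measure of
such a quadratic is `0` for `|B| ≤ 2` and `arcosh (|B| / 2)` otherwise, so the derivatives of
`m(S_α)` and `m(P_α)` in `α` are, in the variable `‖x + 1‖²`, integrals of differentials `ds / √F`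
with a quartic `F`. A substitution of Landen type carries the differential of `P` to that of `S`:
for `0 < α < 4` it covers the interval of integration of `P` twice, for `α < -1` once. The
constants of integration come from `α = 0`, where both measures vanish, and from `α → -∞`, where
both are `log (-α) + o(1)`.
-/

namespace MahlerFamilies

open MeasureTheory Set Filter Polynomial
open scoped Real ENNReal Topology Interval

section UnitCircle

/-- The uniform probability measure on the unit circle of `ℂ`: the law of `exp (iθ)` for `θ`
uniform in `(0, 2π]`. -/
noncomputable def unitCircleMeasure : Measure ℂ :=
  (ENNReal.ofReal (2 * π))⁻¹ • (volume.restrict (Ioc 0 (2 * π))).map (circleMap 0 1)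

theorem measurable_unitCircleMap : Measurable (circleMap 0 1) :=
  (continuous_circleMap 0 1).measurable

instance : IsProbabilityMeasure unitCircleMeasure := by
  refine ⟨?_⟩
  rw [unitCircleMeasure, Measure.smul_apply, Measure.map_apply measurable_unitCircleMap .univ,
    preimage_univ, Measure.restrict_apply_univ, Real.volume_Ioc, sub_zero, smul_eq_mul]
  exact ENNReal.inv_mul_cancel (by simp [Real.pi_pos]) ENNReal.ofReal_ne_top

theorem ae_unitCircle_iff {p : ℂ → Prop} (hp : MeasurableSet {x | p x}) :
    (∀ᵐ x ∂unitCircleMeasure, p x) ↔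
      ∀ᵐ θ ∂volume.restrict (Ioc 0 (2 * π)), p (circleMap 0 1 θ) := by
  rw [unitCircleMeasure,
    Measure.ae_ennreal_smul_measure_iff (ENNReal.inv_ne_zero.mpr ENNReal.ofReal_ne_top),
    ae_map_iff measurable_unitCircleMap.aemeasurable hp]

theorem ae_norm_eq_one : ∀ᵐ x ∂unitCircleMeasure, ‖x‖ = 1 := by
  rw [ae_unitCircle_iff (measurableSet_eq_fun measurable_norm measurable_const)]
  exact Eventually.of_forall fun θ => by simp

instance : NullSingletonClass unitCircleMeasure where
  measure_singleton a := by
    have h : ∀ᵐ x ∂unitCircleMeasure, x ∉ ({a} : Set ℂ) :=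
      (ae_unitCircle_iff (measurableSet_singleton a).compl).mpr <| ae_restrict_of_ae <|
        ((countable_singleton a).preimage_circleMap 0 one_ne_zero).ae_notMem volume
    simpa [ae_iff] using h

theorem integrable_unitCircle_iff {f : ℂ → ℝ} (hf : Measurable f) :
    Integrable f unitCircleMeasure ↔ CircleIntegrable f 0 1 := by
  rw [unitCircleMeasure, integrable_smul_measure (ENNReal.inv_ne_zero.mpr ENNReal.ofReal_ne_top)
      (ENNReal.inv_ne_top.mpr (ENNReal.ofReal_pos.mpr Real.two_pi_pos).ne'),
    integrable_map_measure hf.aestronglyMeasurable measurable_unitCircleMap.aemeasurable,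
    CircleIntegrable, intervalIntegrable_iff_integrableOn_Ioc_of_le Real.two_pi_pos.le]
  rfl

theorem integral_unitCircle {f : ℂ → ℝ} (hf : Measurable f) :
    ∫ x, f x ∂unitCircleMeasure = Real.circleAverage f 0 1 := by
  rw [unitCircleMeasure, integral_smul_measure,
    integral_map measurable_unitCircleMap.aemeasurable hf.aestronglyMeasurable,
    Real.circleAverage_def, intervalIntegral.integral_of_le Real.two_pi_pos.le,
    ENNReal.toReal_inv, ENNReal.toReal_ofReal Real.two_pi_pos.le]

theorem pi_unitCircleMeasure (n : ℕ) :
    Measure.pi (fun _ : Fin n => unitCircleMeasure) = (ENNReal.ofReal (2 * π) ^ n)⁻¹ •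
      (volume.restrict (Icc (0 : Fin n → ℝ) fun _ => 2 * π)).map (torusMap 0 1) := by
  have hmap : (volume.restrict (Icc (0 : Fin n → ℝ) fun _ => 2 * π)).map (torusMap 0 1) =
      Measure.pi fun _ => (volume.restrict (Ioc 0 (2 * π))).map (circleMap 0 1) := by
    rw [← Measure.pi_map_pi fun _ => measurable_unitCircleMap.aemeasurable]
    simp_rw [restrict_Ioc_eq_restrict_Icc]
    rw [← Measure.restrict_pi_pi, pi_univ_Icc]
    rfl
  rw [hmap]
  refine Measure.pi_eq fun s _ => ?_
  simp only [unitCircleMeasure, Measure.smul_apply, Measure.pi_pi, smul_eq_mul,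
    Finset.prod_mul_distrib, Finset.prod_const, Finset.card_univ, Fintype.card_fin,
    ENNReal.inv_pow]

variable {n : ℕ} (P : MvPolynomial (Fin n) ℂ)

theorem measurable_torusMap : Measurable (torusMap (0 : Fin n → ℂ) 1) :=
  measurable_pi_lambda _ fun i => measurable_unitCircleMap.comp (measurable_pi_apply i)

theorem measurable_log_norm_eval : Measurable fun z => Real.log ‖MvPolynomial.eval z P‖ :=
  Real.measurable_log.comp (MvPolynomial.continuous_eval P).norm.measurable

theorem logIntegrable_iff :
    LogIntegrable P ↔ Integrable (fun z => Real.log ‖MvPolynomial.eval z P‖)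
      (Measure.pi fun _ => unitCircleMeasure) := by
  have hc : ENNReal.ofReal (2 * π) ^ n ≠ ∞ := ENNReal.pow_ne_top ENNReal.ofReal_ne_top
  have hc' : ENNReal.ofReal (2 * π) ^ n ≠ 0 :=
    pow_ne_zero n (ENNReal.ofReal_pos.mpr Real.two_pi_pos).ne'
  rw [pi_unitCircleMeasure, integrable_smul_measure (ENNReal.inv_ne_zero.mpr hc)
      (ENNReal.inv_ne_top.mpr hc'),
    integrable_map_measure (measurable_log_norm_eval P).aestronglyMeasurable
      measurable_torusMap.aemeasurable]
  rfl

theorem logMahler_eq_integral :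
    logMahler P = ∫ z, Real.log ‖MvPolynomial.eval z P‖
      ∂Measure.pi fun _ : Fin n => unitCircleMeasure := by
  rw [pi_unitCircleMeasure, integral_smul_measure, integral_map measurable_torusMap.aemeasurable
      (measurable_log_norm_eval P).aestronglyMeasurable, logMahler, ENNReal.toReal_inv,
    ENNReal.toReal_pow, ENNReal.toReal_ofReal Real.two_pi_pos.le, smul_eq_mul]

theorem exists_log_norm_eval_le :
    ∃ M, ∀ z : Fin n → ℂ, (∀ i, ‖z i‖ = 1) → Real.log ‖MvPolynomial.eval z P‖ ≤ M := by
  obtain ⟨C, hC⟩ := (isCompact_univ_pi fun _ : Fin n => isCompact_sphere (0 : ℂ) 1)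
    |>.exists_bound_of_continuousOn (MvPolynomial.continuous_eval P).continuousOn
  refine ⟨C, fun z hz => (Real.log_le_self (norm_nonneg _)).trans (hC z fun i _ => ?_)⟩
  simpa using hz i

end UnitCircle

section Fiber

/-- The polynomial `P(x, ·)` in the second variable that is obtained from `P` by fixing the first
one. -/
noncomputable def fiber (P : MvPolynomial (Fin 2) ℂ) (x : ℂ) : ℂ[X] :=
  MvPolynomial.aeval ![C x, X] P

variable (P : MvPolynomial (Fin 2) ℂ)

theorem eval_fiber (x y : ℂ) : (fiber P x).eval y = MvPolynomial.eval ![x, y] P := by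
  have h : (evalRingHom y).comp (MvPolynomial.aeval (R := ℂ) ![C x, X]).toRingHom =
      MvPolynomial.eval ![x, y] := by
    ext i
    · simp
    · fin_cases i <;> simp
  exact RingHom.congr_fun h P

theorem eval_eq_eval_fiber (z : Fin 2 → ℂ) :
    MvPolynomial.eval z P = (fiber P (z 0)).eval (z 1) := by
  rw [eval_fiber]
  congr 2
  ext i
  fin_cases i <;> rfl

theorem measurable_log_norm_eval_fiber :
    Measurable fun z : ℂ × ℂ => Real.log ‖(fiber P z.1).eval z.2‖ := by
  simp only [eval_fiber]
  refine (measurable_log_norm_eval P).comp (measurable_pi_lambda _ fun i => ?_)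
  fin_cases i
  exacts [measurable_fst, measurable_snd]

theorem integrable_log_norm_eval (p : ℂ[X]) :
    Integrable (fun y => Real.log ‖p.eval y‖) unitCircleMeasure :=
  (integrable_unitCircle_iff (Real.measurable_log.comp p.continuous.norm.measurable)).mpr
    p.intervalIntegrable_mahlerMeasure

theorem integral_log_norm_eval (p : ℂ[X]) :
    ∫ y, Real.log ‖p.eval y‖ ∂unitCircleMeasure = p.logMahlerMeasure :=
  (integral_unitCircle (Real.measurable_log.comp p.continuous.norm.measurable)).trans
    (logMahlerMeasure_def p).symm

theorem logIntegrable_iff_prod :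
    LogIntegrable P ↔ Integrable (fun z : ℂ × ℂ => Real.log ‖(fiber P z.1).eval z.2‖)
      (unitCircleMeasure.prod unitCircleMeasure) := by
  rw [logIntegrable_iff]
  simp only [eval_eq_eval_fiber]
  exact (measurePreserving_finTwoArrow unitCircleMeasure).integrable_comp_emb
    (g := fun z : ℂ × ℂ => Real.log ‖(fiber P z.1).eval z.2‖)
    MeasurableEquiv.finTwoArrow.measurableEmbedding

theorem logMahler_eq_integral_prod :
    logMahler P = ∫ z : ℂ × ℂ, Real.log ‖(fiber P z.1).eval z.2‖
      ∂unitCircleMeasure.prod unitCircleMeasure := by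
  simp only [logMahler_eq_integral, eval_eq_eval_fiber]
  exact (measurePreserving_finTwoArrow unitCircleMeasure).integral_comp
    MeasurableEquiv.finTwoArrow.measurableEmbedding
      fun z : ℂ × ℂ => Real.log ‖(fiber P z.1).eval z.2‖

variable {P}

theorem logIntegrable_of_le_logMahlerMeasure_fiber {g : ℂ → ℝ}
    (hg : Integrable g unitCircleMeasure)
    (h : ∀ᵐ x ∂unitCircleMeasure, g x ≤ (fiber P x).logMahlerMeasure) : LogIntegrable P := by
  have hmeas := measurable_log_norm_eval_fiber P
  obtain ⟨M, hM⟩ := exists_log_norm_eval_le P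
  rw [logIntegrable_iff_prod, integrable_prod_iff hmeas.aestronglyMeasurable]
  refine ⟨Eventually.of_forall fun x => integrable_log_norm_eval (fiber P x),
    ((integrable_const (2 * |M|)).sub hg).mono'
      hmeas.norm.stronglyMeasurable.integral_prod_right.aestronglyMeasurable ?_⟩
  filter_upwards [h, ae_norm_eq_one] with x hgx hx
  -- If `f ≤ |M|`, then `|f| = 2 f⁺ - f ≤ 2 |M| - f`.
  have hle : ∀ᵐ y ∂unitCircleMeasure, ‖Real.log ‖(fiber P x).eval y‖‖ ≤
      2 * |M| - Real.log ‖(fiber P x).eval y‖ := by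
    filter_upwards [ae_norm_eq_one] with y hy
    have := hM ![x, y] (by simp [Fin.forall_fin_two, hx, hy])
    rw [Real.norm_eq_abs, abs_le, eval_fiber]
    constructor <;> linarith [le_abs_self M, abs_nonneg M]
  calc ‖∫ y, ‖Real.log ‖(fiber P x).eval y‖‖ ∂unitCircleMeasure‖
      = ∫ y, ‖Real.log ‖(fiber P x).eval y‖‖ ∂unitCircleMeasure :=
        Real.norm_of_nonneg (integral_nonneg fun _ => norm_nonneg _)
    _ ≤ ∫ y, (2 * |M| - Real.log ‖(fiber P x).eval y‖) ∂unitCircleMeasure :=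
        integral_mono_ae (integrable_log_norm_eval _).norm
          ((integrable_const _).sub (integrable_log_norm_eval _)) hle
    _ = 2 * |M| - (fiber P x).logMahlerMeasure := by
        rw [integral_sub (integrable_const _) (integrable_log_norm_eval _),
          integral_log_norm_eval]
        simp
    _ ≤ 2 * |M| - g x := by linarith

theorem LogIntegrable.integrable_logMahlerMeasure_fiber (h : LogIntegrable P) :
    Integrable (fun x => (fiber P x).logMahlerMeasure) unitCircleMeasure := by
  simpa only [integral_log_norm_eval] using ((logIntegrable_iff_prod P).mp h).integral_prod_left

theorem LogIntegrable.logMahler_eq_integral_fiber (h : LogIntegrable P) :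
    logMahler P = ∫ x, (fiber P x).logMahlerMeasure ∂unitCircleMeasure := by
  rw [logMahler_eq_integral_prod, integral_prod _ ((logIntegrable_iff_prod P).mp h)]
  simp only [integral_log_norm_eval]

end Fiber

section Quadratic

/-- The logarithmic Mahler measure of `y² + B y + 1` for a real number `B`. -/
noncomputable def quadMahler (B : ℝ) : ℝ := Real.arcosh (max 1 (|B| / 2))

theorem quadMahler_nonneg (B : ℝ) : 0 ≤ quadMahler B := Real.arcosh_nonneg (le_max_left _ _)

theorem quadMahler_neg (B : ℝ) : quadMahler (-B) = quadMahler B := by simp [quadMahler]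

theorem continuous_quadMahler : Continuous quadMahler :=
  Real.continuousOn_arcosh.comp_continuous (by fun_prop)
    fun _ => mem_Ici.mpr (le_max_left _ _)

theorem quadMahler_of_abs_le {B : ℝ} (h : |B| ≤ 2) : quadMahler B = 0 := by
  rw [quadMahler, max_eq_left (by linarith), Real.arcosh_zero]

theorem quadMahler_of_two_le {B : ℝ} (h : 2 ≤ B) : quadMahler B = Real.arcosh (B / 2) := by
  rw [quadMahler, abs_of_nonneg (by linarith), max_eq_right (by linarith)]

theorem quadratic_ne_zero (b c : ℂ) : X ^ 2 + C b * X + C c ≠ 0 := by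
  rw [add_assoc]
  exact (monic_X_pow_add degree_linear_lt).ne_zero

theorem posLog_exp_add_posLog_exp_neg (t : ℝ) :
    Real.posLog (Real.exp t) + Real.posLog (Real.exp (-t)) = |t| := by
  simp only [Real.posLog, Real.log_exp]
  rcases le_total 0 t with h | h
  · rw [max_eq_right h, max_eq_left (neg_nonpos.mpr h), add_zero, abs_of_nonneg h]
  · rw [max_eq_left h, max_eq_right (neg_nonneg.mpr h), zero_add, abs_of_nonpos h]

theorem logMahlerMeasure_quadratic_cosh {u : ℂ} (hu : ‖u‖ = 1) (z : ℂ) :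
    (X ^ 2 + C (u * (2 * Complex.cosh z)) * X + C (u ^ 2)).logMahlerMeasure = |z.re| := by
  have hfactor : X ^ 2 + C (u * (2 * Complex.cosh z)) * X + C (u ^ 2) =
      (X + C (u * Complex.exp z)) * (X + C (u * Complex.exp (-z))) := by
    have hmul : u ^ 2 = u * Complex.exp z * (u * Complex.exp (-z)) := by
      rw [mul_mul_mul_comm, ← Complex.exp_add, add_neg_cancel, Complex.exp_zero, mul_one, sq]
    rw [Complex.two_cosh, hmul]
    simp only [map_add, map_mul]
    ring
  rw [hfactor, logMahlerMeasure_mul_eq_add_logMahlerMeasure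
      (mul_ne_zero (X_add_C_ne_zero _) (X_add_C_ne_zero _)),
    logMahlerMeasure_X_add_C, logMahlerMeasure_X_add_C, norm_mul, norm_mul, hu, one_mul, one_mul,
    Complex.norm_exp, Complex.norm_exp, Complex.neg_re, posLog_exp_add_posLog_exp_neg]

theorem logMahlerMeasure_quadratic {u : ℂ} (hu : ‖u‖ = 1) (B : ℝ) :
    (X ^ 2 + C (u * B) * X + C (u ^ 2)).logMahlerMeasure = quadMahler B := by
  wlog hB : 0 ≤ B generalizing u B
  · have h := this (u := -u) (by rwa [norm_neg]) (-B) (by linarith)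
    rwa [Complex.ofReal_neg, neg_mul_neg, neg_sq, quadMahler_neg] at h
  rcases le_total B 2 with h | h
  · have hz : (B : ℂ) = 2 * Complex.cosh (Real.arccos (B / 2) * Complex.I) := by
      rw [Complex.cosh_mul_I, ← Complex.ofReal_cos,
        Real.cos_arccos (by linarith) (by linarith)]
      push_cast
      ring
    rw [hz, logMahlerMeasure_quadratic_cosh hu, Complex.re_ofReal_mul, Complex.I_re, mul_zero,
      abs_zero, quadMahler_of_abs_le (abs_le.mpr ⟨by linarith, h⟩)]
  · have hz : (B : ℂ) = 2 * Complex.cosh (quadMahler B : ℂ) := by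
      rw [quadMahler_of_two_le h, ← Complex.ofReal_cosh, Real.cosh_arcosh (by linarith)]
      push_cast
      ring
    rw [hz, logMahlerMeasure_quadratic_cosh hu, Complex.ofReal_re,
      abs_of_nonneg (quadMahler_nonneg B)]

end Quadratic

section Families

theorem add_one_sq_eq {x : ℂ} (hx : ‖x‖ = 1) : (x + 1) ^ 2 = x * ‖x + 1‖ ^ 2 := by
  have hconj : x * (starRingEnd ℂ) x = 1 := by rw [Complex.mul_conj']; simp [hx]
  rw [← Complex.mul_conj' (x + 1), map_add, map_one]
  linear_combination (-(x + 1)) * hconj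

theorem norm_add_one_pos {x : ℂ} (hx : x ≠ -1) : 0 < ‖x + 1‖ :=
  norm_pos_iff.mpr fun h => hx (eq_neg_of_add_eq_zero_left h)

theorem exists_sq_eq_and_add_one_eq {x : ℂ} (hx : ‖x‖ = 1) (hx' : x ≠ -1) :
    ∃ u : ℂ, ‖u‖ = 1 ∧ u ^ 2 = x ∧ x + 1 = u * ‖x + 1‖ := by
  have hρ : (‖x + 1‖ : ℂ) ≠ 0 := Complex.ofReal_ne_zero.mpr (norm_add_one_pos hx').ne'
  refine ⟨(x + 1) / ‖x + 1‖, ?_, ?_, (div_mul_cancel₀ _ hρ).symm⟩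
  · rw [norm_div, Complex.norm_real, norm_norm, div_self (norm_add_one_pos hx').ne']
  · rw [div_pow, add_one_sq_eq hx, mul_div_cancel_right₀ _ (pow_ne_zero 2 hρ)]

theorem norm_add_one_le {x : ℂ} (hx : ‖x‖ = 1) : ‖x + 1‖ ≤ 2 := by
  calc ‖x + 1‖ ≤ ‖x‖ + ‖(1 : ℂ)‖ := norm_add_le _ _
    _ = 2 := by rw [hx, norm_one]; norm_num

theorem ae_norm_add_one :
    ∀ᵐ x ∂unitCircleMeasure, 0 < ‖x + 1‖ ∧ ‖x + 1‖ ≤ 2 := by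
  filter_upwards [ae_norm_eq_one, Measure.ae_ne unitCircleMeasure (-1)] with x hx hx'
  exact ⟨norm_add_one_pos hx', norm_add_one_le hx⟩

theorem integrable_log_norm_add_one :
    Integrable (fun x : ℂ => Real.log ‖x + 1‖) unitCircleMeasure := by
  refine (integrable_log_norm_eval (X + C 1)).congr (Eventually.of_forall fun x => ?_)
  simp only [eval_add, eval_X, eval_C]

theorem integral_log_norm_add_one : ∫ x : ℂ, Real.log ‖x + 1‖ ∂unitCircleMeasure = 0 := by
  have h := integral_log_norm_eval (X + C 1)
  simpa only [eval_add, eval_X, eval_C, logMahlerMeasure_X_add_C, norm_one, Real.posLog_one]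
    using h

theorem fiber_polyS (α : ℝ) (x : ℂ) : fiber (polyS α) x =
    X ^ 2 + C (x ^ 4 + α * x ^ 3 + 2 * α * x ^ 2 + α * x + 1) * X + C (x ^ 4) := by
  have h2 : (2 : ℂ[X]) = C 2 := (map_ofNat C 2).symm
  simp [fiber, polyS, h2]

theorem logMahlerMeasure_fiber_polyS (α : ℝ) {x : ℂ} (hx : ‖x‖ = 1) :
    (fiber (polyS α) x).logMahlerMeasure =
      quadMahler ((‖x + 1‖ ^ 2 - 2) ^ 2 - 2 + ‖x + 1‖ ^ 2 * α) := by
  have hcoeff : x ^ 4 + α * x ^ 3 + 2 * α * x ^ 2 + α * x + 1 =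
      x ^ 2 * (((‖x + 1‖ ^ 2 - 2) ^ 2 - 2 + ‖x + 1‖ ^ 2 * α : ℝ) : ℂ) := by
    push_cast
    linear_combination
      (α * x + ((x + 1) ^ 2 + x * ‖x + 1‖ ^ 2 - 4 * x)) * add_one_sq_eq hx
  rw [fiber_polyS, hcoeff, show x ^ 4 = (x ^ 2) ^ 2 by ring,
    logMahlerMeasure_quadratic (by rw [norm_pow, hx, one_pow])]

theorem fiber_polyP (α : ℝ) (x : ℂ) : fiber (polyP α) x =
    C (x + 1) * X ^ 2 + C ((x + 1) ^ 2 - α * x) * X + C ((x + 1) * x) := by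
  simp only [fiber, polyP, map_add, map_sub, map_mul, map_pow, map_one, MvPolynomial.aeval_X,
    MvPolynomial.aeval_C, algebraMap_eq, Matrix.cons_val_zero, Matrix.cons_val_one]
  ring

theorem logMahlerMeasure_fiber_polyP (α : ℝ) {x : ℂ} (hx : ‖x‖ = 1) (hx' : x ≠ -1) :
    (fiber (polyP α) x).logMahlerMeasure =
      Real.log ‖x + 1‖ + quadMahler (-‖x + 1‖ + ‖x + 1‖⁻¹ * α) := by
  obtain ⟨u, hu, hu2, hxu⟩ := exists_sq_eq_and_add_one_eq hx hx'
  have hcoeff : (x + 1) ^ 2 - α * x =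
      (x + 1) * (u * ((-(-‖x + 1‖ + ‖x + 1‖⁻¹ * α) : ℝ) : ℂ)) := by
    have hρ : (‖x + 1‖ : ℂ) * (‖x + 1‖ : ℂ)⁻¹ = 1 :=
      mul_inv_cancel₀ (Complex.ofReal_ne_zero.mpr (norm_add_one_pos hx').ne')
    push_cast
    linear_combination
      (x + 1 + α * u * (‖x + 1‖ : ℂ)⁻¹) * hxu + α * u ^ 2 * hρ + α * hu2
  have hfactor : fiber (polyP α) x = C (x + 1) *
      (X ^ 2 + C (u * ((-(-‖x + 1‖ + ‖x + 1‖⁻¹ * α) : ℝ) : ℂ)) * X + C (u ^ 2)) := by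
    rw [fiber_polyP, hcoeff, hu2, C_mul (a := x + 1), C_mul (a := x + 1)]
    ring
  rw [hfactor, logMahlerMeasure_C_mul (norm_pos_iff.mp (norm_add_one_pos hx'))
      (quadratic_ne_zero _ _), logMahlerMeasure_quadratic hu, quadMahler_neg]

end Families

section Growth

theorem hasDerivAt_quadMahler {B : ℝ} (h : 2 < B) :
    HasDerivAt quadMahler (1 / √(B ^ 2 - 4)) B := by
  have hcomp : HasDerivAt (fun x : ℝ => Real.arcosh (x / 2))
      ((√((B / 2) ^ 2 - 1))⁻¹ * (1 / 2)) B :=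
    HasDerivAt.comp (h₂ := Real.arcosh) (h := fun x => x / 2) B
      (Real.hasDerivAt_arcosh (mem_Ioi.mpr (by linarith))) ((hasDerivAt_id B).div_const 2)
  have hsqrt : (√((B / 2) ^ 2 - 1))⁻¹ * (1 / 2) = 1 / √(B ^ 2 - 4) := by
    rw [show B ^ 2 - 4 = 2 ^ 2 * ((B / 2) ^ 2 - 1) by ring, Real.sqrt_mul (by norm_num),
      Real.sqrt_sq zero_le_two, inv_eq_one_div, one_div_mul_one_div_rev]
  rw [← hsqrt]
  refine hcomp.congr_of_eventuallyEq ?_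
  filter_upwards [eventually_gt_nhds h] with x hx using quadMahler_of_two_le hx.le

/-- The derivative of `quadMahler` off `[-2, 2]`, up to sign; it vanishes on `[-2, 2]` because
the square root of a negative number is `0`. -/
noncomputable def quadKernel (u : ℝ) : ℝ≥0∞ := ENNReal.ofReal (1 / √(u ^ 2 - 4))

theorem measurable_quadKernel : Measurable quadKernel := by
  unfold quadKernel
  fun_prop

theorem quadKernel_neg (u : ℝ) : quadKernel (-u) = quadKernel u := by
  simp only [quadKernel, neg_sq]

theorem quadKernel_of_abs_le {u : ℝ} (h : |u| ≤ 2) : quadKernel u = 0 := by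
  have : u ^ 2 - 4 ≤ 0 := by nlinarith [abs_le.mp h]
  simp [quadKernel, Real.sqrt_eq_zero_of_nonpos this]

theorem setLIntegral_Ioc_two_quadKernel {x : ℝ} (hx : 2 ≤ x) :
    ∫⁻ u in Ioc 2 x, quadKernel u = ENNReal.ofReal (quadMahler x) := by
  have hderiv : ∀ u ∈ Ioo 2 x, HasDerivAt quadMahler (1 / √(u ^ 2 - 4)) u :=
    fun u hu => hasDerivAt_quadMahler hu.1
  have hint : IntegrableOn (fun u : ℝ => 1 / √(u ^ 2 - 4)) (Ioc 2 x) :=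
    intervalIntegral.integrableOn_deriv_of_nonneg continuous_quadMahler.continuousOn hderiv
      fun u _ => by positivity
  have hFTC := intervalIntegral.integral_eq_sub_of_hasDerivAt_of_le hx
    continuous_quadMahler.continuousOn hderiv
    ((intervalIntegrable_iff_integrableOn_Ioc_of_le hx).mpr hint)
  rw [intervalIntegral.integral_of_le hx, quadMahler_of_abs_le (B := 2) (by norm_num),
    sub_zero] at hFTC
  rw [← hFTC,
    ofReal_integral_eq_lintegral_ofReal hint (Eventually.of_forall fun u => by positivity)]
  rfl

theorem setLIntegral_Ioc_quadKernel {p x : ℝ} (hp : |p| ≤ 2) (hpx : p ≤ x) :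
    ∫⁻ u in Ioc p x, quadKernel u = ENNReal.ofReal (quadMahler x) := by
  obtain ⟨hp₁, hp₂⟩ := abs_le.mp hp
  have hzero : ∀ y ≤ 2, ∫⁻ u in Ioc p y, quadKernel u = 0 := fun y hy => by
    refine setLIntegral_eq_zero measurableSet_Ioc fun u hu => quadKernel_of_abs_le ?_
    exact abs_le.mpr ⟨hp₁.trans hu.1.le, hu.2.trans hy⟩
  rcases le_total x 2 with hx | hx
  · rw [hzero x hx, quadMahler_of_abs_le (abs_le.mpr ⟨hp₁.trans hpx, hx⟩), ENNReal.ofReal_zero]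
  · rw [← Ioc_union_Ioc_eq_Ioc hp₂ hx, lintegral_union measurableSet_Ioc
      (Ioc_disjoint_Ioc_of_le le_rfl), hzero 2 le_rfl, zero_add, setLIntegral_Ioc_two_quadKernel hx]

theorem setLIntegral_uIoc_quadKernel {p : ℝ} (hp : |p| ≤ 2) (x : ℝ) :
    ∫⁻ u in Ι p x, quadKernel u = ENNReal.ofReal (quadMahler x) := by
  rcases le_total p x with h | h
  · rw [uIoc_of_le h, setLIntegral_Ioc_quadKernel hp h]
  · rw [uIoc_of_ge h, ← quadMahler_neg, ← setLIntegral_Ioc_quadKernel (by rwa [abs_neg])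
      (neg_le_neg h), ← (Measure.measurePreserving_neg volume).setLIntegral_comp_preimage
        measurableSet_Ioc measurable_quadKernel, neg_preimage, neg_Ioc]
    simp only [quadKernel_neg]
    exact setLIntegral_congr Ico_ae_eq_Ioc

theorem setLIntegral_quadKernel_affine {p q : ℝ} (hp : |p| ≤ 2) (hq : 0 < q) (τ : ℝ) :
    ∫⁻ t in Ι 0 τ, ENNReal.ofReal q * quadKernel (p + q * t) =
      ENNReal.ofReal (quadMahler (p + q * τ)) := by
  have himage : (fun t => p + q * t) '' Ι 0 τ = Ι p (p + q * τ) := by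
    have haffine := image_affine_Ioc hq p
    simp only [add_comm _ p] at haffine
    rcases le_total 0 τ with hτ | hτ
    · rw [uIoc_of_le hτ, haffine, mul_zero, add_zero, uIoc_of_le (by nlinarith)]
    · rw [uIoc_of_ge hτ, haffine, mul_zero, add_zero, uIoc_of_ge (by nlinarith)]
  have hderiv : ∀ t ∈ Ι 0 τ, HasDerivWithinAt (fun t => p + q * t) q (Ι 0 τ) t := fun t _ => by
    simpa using (((hasDerivAt_id t).const_mul q).const_add p).hasDerivWithinAt
  have hinj : InjOn (fun t => p + q * t) (Ι 0 τ) := fun t _ t' _ h =>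
    mul_left_cancel₀ hq.ne' (add_left_cancel h)
  rw [← setLIntegral_uIoc_quadKernel hp, ← himage,
    lintegral_image_eq_lintegral_abs_deriv_mul measurableSet_uIoc hderiv hinj, abs_of_pos hq]

variable {Ω : Type*} [MeasurableSpace Ω] {μ : Measure Ω} {p q : Ω → ℝ}

/-- The derivative at `t`, up to sign, of `∫ x, quadMahler (p x + q x * t) ∂μ`, as an extended
nonnegative real. -/
noncomputable def growthRate (μ : Measure Ω) (p q : Ω → ℝ) (t : ℝ) : ℝ≥0∞ :=
  ∫⁻ x, ENNReal.ofReal (q x) * quadKernel (p x + q x * t) ∂μ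

theorem lintegral_quadMahler_affine [SFinite μ] (hp : Measurable p) (hq : Measurable q)
    (hp2 : ∀ᵐ x ∂μ, |p x| ≤ 2) (hq0 : ∀ᵐ x ∂μ, 0 < q x) (τ : ℝ) :
    ∫⁻ x, ENNReal.ofReal (quadMahler (p x + q x * τ)) ∂μ =
      ∫⁻ t in Ι 0 τ, growthRate μ p q t := by
  have hmeas : Measurable (Function.uncurry fun (t : ℝ) (x : Ω) =>
      ENNReal.ofReal (q x) * quadKernel (p x + q x * t)) := by
    have := measurable_quadKernel
    unfold Function.uncurry
    fun_prop
  simp only [growthRate]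
  rw [lintegral_lintegral_swap hmeas.aemeasurable]
  refine lintegral_congr_ae ?_
  filter_upwards [hp2, hq0] with x hpx hqx
  exact (setLIntegral_quadKernel_affine hpx hqx τ).symm

theorem integral_quadMahler_affine [SFinite μ] (hp : Measurable p) (hq : Measurable q)
    (hp2 : ∀ᵐ x ∂μ, |p x| ≤ 2) (hq0 : ∀ᵐ x ∂μ, 0 < q x) (τ : ℝ) :
    ∫ x, quadMahler (p x + q x * τ) ∂μ = (∫⁻ t in Ι 0 τ, growthRate μ p q t).toReal := by
  rw [integral_eq_lintegral_of_nonneg_ae (Eventually.of_forall fun x => quadMahler_nonneg _)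
      (continuous_quadMahler.measurable.comp (by fun_prop)).aestronglyMeasurable,
    lintegral_quadMahler_affine hp hq hp2 hq0]

theorem integral_quadMahler_affine_sub [SFinite μ] (hp : Measurable p) (hq : Measurable q)
    (hp2 : ∀ᵐ x ∂μ, |p x| ≤ 2) (hq0 : ∀ᵐ x ∂μ, 0 < q x) {τ' τ : ℝ} (hτ' : τ' ≤ τ) (hτ : τ ≤ 0)
    (hint : Integrable (fun x => quadMahler (p x + q x * τ')) μ) :
    ∫ x, quadMahler (p x + q x * τ') ∂μ - ∫ x, quadMahler (p x + q x * τ) ∂μ =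
      (∫⁻ t in Ioc τ' τ, growthRate μ p q t).toReal := by
  have hsplit : ∫⁻ t in Ι 0 τ', growthRate μ p q t =
      (∫⁻ t in Ioc τ' τ, growthRate μ p q t) + ∫⁻ t in Ι 0 τ, growthRate μ p q t := by
    rw [uIoc_of_ge (hτ'.trans hτ), uIoc_of_ge hτ, ← Ioc_union_Ioc_eq_Ioc hτ' hτ,
      lintegral_union measurableSet_Ioc (Ioc_disjoint_Ioc_of_le le_rfl)]
  have hfin : ∫⁻ t in Ι 0 τ', growthRate μ p q t ≠ ∞ := by
    rw [← lintegral_quadMahler_affine hp hq hp2 hq0]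
    exact hint.lintegral_lt_top.ne
  rw [hsplit, ENNReal.add_ne_top] at hfin
  rw [integral_quadMahler_affine hp hq hp2 hq0, integral_quadMahler_affine hp hq hp2 hq0, hsplit,
    ENNReal.toReal_add hfin.1 hfin.2, add_sub_cancel_right]

end Growth

section Asymptotics

theorem exp_quadMahler_le (B : ℝ) : Real.exp (quadMahler B) ≤ |B| + 2 := by
  rw [quadMahler, Real.exp_arcosh (le_max_left _ _)]
  set m := max 1 (|B| / 2)
  have hm1 : 1 ≤ m := le_max_left _ _
  have hsqrt : √(m ^ 2 - 1) ≤ m :=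
    (Real.sqrt_le_sqrt (by linarith)).trans_eq (Real.sqrt_sq (by linarith))
  have hmB : m ≤ 1 + |B| / 2 := max_le (by linarith [abs_nonneg B]) (by linarith)
  linarith

theorem le_exp_quadMahler (B : ℝ) : |B| - 1 ≤ Real.exp (quadMahler B) := by
  rw [quadMahler, Real.exp_arcosh (le_max_left _ _)]
  set m := max 1 (|B| / 2)
  have hm1 : 1 ≤ m := le_max_left _ _
  have hsqrt : m - 1 ≤ √(m ^ 2 - 1) := Real.le_sqrt_of_sq_le (by nlinarith)
  have hmB : |B| / 2 ≤ m := le_max_right _ _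
  linarith

theorem abs_quadMahler_sub_log_le {B Y : ℝ} (hBY : |B + Y| ≤ 2) (hY : 0 < Y) :
    |quadMahler B - Real.log Y| ≤ Real.log (1 + 12 / Y) := by
  have hB : |(|B| - Y)| ≤ 2 := by
    calc |(|B| - Y)| = |(|B| - |(-Y)|)| := by rw [abs_neg, abs_of_pos hY]
      _ ≤ |B - -Y| := abs_abs_sub_abs_le _ _
      _ ≤ 2 := by rwa [sub_neg_eq_add]
  have hc : 0 < 1 + 12 / Y := by positivity
  obtain ⟨hB₁, hB₂⟩ := abs_le.mp hB
  rw [abs_sub_le_iff, sub_le_iff_le_add, sub_le_comm, ← Real.log_mul hc.ne' hY.ne',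
    ← Real.log_div hY.ne' hc.ne', Real.le_log_iff_exp_le (by positivity),
    Real.log_le_iff_le_exp (by positivity)]
  constructor
  · calc Real.exp (quadMahler B) ≤ |B| + 2 := exp_quadMahler_le B
      _ ≤ (1 + 12 / Y) * Y := by
        rw [add_mul, one_mul, div_mul_cancel₀ _ hY.ne']
        linarith
  · have h1 : 1 ≤ Real.exp (quadMahler B) := Real.one_le_exp (quadMahler_nonneg B)
    have h2 := le_exp_quadMahler B
    rw [div_le_iff₀ hc]
    rcases le_total Y 4 with h4 | h4
    · have : 3 ≤ 12 / Y := by rw [le_div_iff₀ hY]; linarith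
      nlinarith
    · have : 12 / Y ≤ 3 := by rw [div_le_iff₀ hY]; linarith
      have hmul : 12 / Y * Y = 12 := div_mul_cancel₀ _ hY.ne'
      nlinarith

variable {Ω : Type*} [MeasurableSpace Ω] {μ : Measure Ω} {p q : Ω → ℝ}

theorem log_one_add_div_le {y τ : ℝ} (hy : 0 < y) (hτ : τ ≤ -1) :
    Real.log (1 + 12 / -(y * τ)) ≤ Real.log 13 + |Real.log y| := by
  have hY : y ≤ -(y * τ) := by nlinarith
  have hY0 : 0 < -(y * τ) := hy.trans_le hY
  have hdiv : 12 / -(y * τ) ≤ 12 * Real.exp |Real.log y| := by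
    calc 12 / -(y * τ) ≤ 12 / y := by gcongr
      _ = 12 * Real.exp (-Real.log y) := by rw [Real.exp_neg, Real.exp_log hy, div_eq_mul_inv]
      _ ≤ 12 * Real.exp |Real.log y| := by gcongr; exact neg_le_abs _
  have hone : 1 ≤ Real.exp |Real.log y| := Real.one_le_exp (abs_nonneg _)
  rw [← Real.log_exp |Real.log y|, ← Real.log_mul (by norm_num) (Real.exp_ne_zero _)]
  exact Real.log_le_log (by positivity) (by linarith)

theorem tendsto_quadMahler_sub_log {a b : ℝ} (ha : |a| ≤ 2) (hb : 0 < b) :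
    Tendsto (fun τ => quadMahler (a + b * τ) - Real.log (-(b * τ))) atBot (𝓝 0) := by
  have hbot : Tendsto (fun τ => -(b * τ)) atBot atTop :=
    tendsto_neg_atBot_atTop.comp (tendsto_id.const_mul_atBot hb)
  have hlog : Tendsto (fun τ => Real.log (1 + 12 / -(b * τ))) atBot (𝓝 0) := by
    have h := ((hbot.const_div_atTop 12).const_add 1).log (by norm_num)
    rwa [add_zero, Real.log_one] at h
  refine squeeze_zero_norm' ?_ hlog
  filter_upwards [hbot.eventually_gt_atTop 0] with τ hτ
  exact abs_quadMahler_sub_log_le (by simpa using ha) hτ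

theorem tendsto_integral_quadMahler_sub_log [IsProbabilityMeasure μ] (hp : Measurable p)
    (hq : Measurable q) (hp2 : ∀ᵐ x ∂μ, |p x| ≤ 2) (hq0 : ∀ᵐ x ∂μ, 0 < q x)
    (hlog : Integrable (fun x => Real.log (q x)) μ) :
    Tendsto (fun τ => ∫ x, quadMahler (p x + q x * τ) ∂μ - Real.log (-τ)) atBot
      (𝓝 (∫ x, Real.log (q x) ∂μ)) := by
  have hmeas : ∀ τ, AEStronglyMeasurable
      (fun x => quadMahler (p x + q x * τ) - Real.log (-(q x * τ))) μ := fun τ =>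
    ((continuous_quadMahler.measurable.comp (by fun_prop)).sub
      (Real.measurable_log.comp (by fun_prop))).aestronglyMeasurable
  have hbound_int : Integrable (fun x => Real.log 13 + |Real.log (q x)|) μ :=
    (integrable_const _).add hlog.abs
  have hbound : ∀ τ ≤ -1, ∀ᵐ x ∂μ,
      ‖quadMahler (p x + q x * τ) - Real.log (-(q x * τ))‖ ≤ Real.log 13 + |Real.log (q x)| := by
    intro τ hτ
    filter_upwards [hp2, hq0] with x hpx hqx
    exact (abs_quadMahler_sub_log_le (by simpa using hpx) (by nlinarith)).trans
      (log_one_add_div_le hqx hτ)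
  have hzero : Tendsto (fun τ => ∫ x, (quadMahler (p x + q x * τ) - Real.log (-(q x * τ))) ∂μ)
      atBot (𝓝 0) := by
    rw [← integral_zero Ω ℝ (μ := μ)]
    refine tendsto_integral_filter_of_dominated_convergence _ (Eventually.of_forall hmeas)
      ((eventually_le_atBot (-1)).mono hbound) hbound_int ?_
    filter_upwards [hp2, hq0] with x hpx hqx using tendsto_quadMahler_sub_log hpx hqx
  have hsum := hzero.add_const (∫ x, Real.log (q x) ∂μ)
  rw [zero_add] at hsum
  refine hsum.congr' ?_
  filter_upwards [eventually_le_atBot (-1)] with τ hτ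
  have hsplit : ∀ᵐ x ∂μ, quadMahler (p x + q x * τ) =
      (quadMahler (p x + q x * τ) - Real.log (-(q x * τ))) + Real.log (q x) + Real.log (-τ) := by
    filter_upwards [hq0] with x hqx
    rw [← mul_neg, Real.log_mul hqx.ne' (by linarith)]
    ring
  have hint := hbound_int.mono' (hmeas τ) (hbound τ hτ)
  rw [integral_congr_ae hsplit,
    integral_add (show Integrable (fun x => _ + _) μ from hint.add hlog) (integrable_const _),
    integral_add hint hlog, integral_const, probReal_univ, one_smul, add_sub_cancel_right]

end Asymptotics

section MahlerMeasures

/-- The Mahler measure of the fiber `S_α(x, ·)` over a point `x` of the unit circle is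
`quadMahler (offsetS x + slopeS x * α)`. -/
noncomputable def offsetS (x : ℂ) : ℝ := (‖x + 1‖ ^ 2 - 2) ^ 2 - 2

/-- The slope in `α` of the affine function described at `offsetS`. -/
noncomputable def slopeS (x : ℂ) : ℝ := ‖x + 1‖ ^ 2

/-- The Mahler measure of the fiber `P_α(x, ·)` over a point `x ≠ -1` of the unit circle is
`log ‖x + 1‖ + quadMahler (offsetP x + slopeP x * α)`. -/
noncomputable def offsetP (x : ℂ) : ℝ := -‖x + 1‖

/-- The slope in `α` of the affine function described at `offsetP`. -/
noncomputable def slopeP (x : ℂ) : ℝ := ‖x + 1‖⁻¹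

theorem measurable_offsetS : Measurable offsetS := by unfold offsetS; fun_prop

theorem measurable_slopeS : Measurable slopeS := by unfold slopeS; fun_prop

theorem measurable_offsetP : Measurable offsetP := by unfold offsetP; fun_prop

theorem measurable_slopeP : Measurable slopeP := by unfold slopeP; fun_prop

theorem ae_abs_offsetS_le : ∀ᵐ x ∂unitCircleMeasure, |offsetS x| ≤ 2 := by
  filter_upwards [ae_norm_add_one] with x ⟨hx₁, hx₂⟩
  have hs : ‖x + 1‖ ^ 2 ≤ 4 := by nlinarith
  rw [offsetS, abs_le]
  constructor <;> nlinarith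

theorem ae_slopeS_pos : ∀ᵐ x ∂unitCircleMeasure, 0 < slopeS x :=
  ae_norm_add_one.mono fun _ hx => pow_pos hx.1 2

theorem ae_abs_offsetP_le : ∀ᵐ x ∂unitCircleMeasure, |offsetP x| ≤ 2 :=
  ae_norm_add_one.mono fun _ hx => by rw [offsetP, abs_neg, abs_norm]; exact hx.2

theorem ae_slopeP_pos : ∀ᵐ x ∂unitCircleMeasure, 0 < slopeP x :=
  ae_norm_add_one.mono fun _ hx => inv_pos.mpr hx.1

theorem log_slopeS (x : ℂ) : Real.log (slopeS x) = 2 * Real.log ‖x + 1‖ := by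
  rw [slopeS, Real.log_pow, Nat.cast_ofNat]

theorem log_slopeP (x : ℂ) : Real.log (slopeP x) = -Real.log ‖x + 1‖ := Real.log_inv _

theorem ae_logMahlerMeasure_fiber_polyS (α : ℝ) : ∀ᵐ x ∂unitCircleMeasure,
    (fiber (polyS α) x).logMahlerMeasure = quadMahler (offsetS x + slopeS x * α) :=
  ae_norm_eq_one.mono fun _ hx => logMahlerMeasure_fiber_polyS α hx

theorem ae_logMahlerMeasure_fiber_polyP (α : ℝ) : ∀ᵐ x ∂unitCircleMeasure,
    (fiber (polyP α) x).logMahlerMeasure =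
      Real.log ‖x + 1‖ + quadMahler (offsetP x + slopeP x * α) := by
  filter_upwards [ae_norm_eq_one, Measure.ae_ne unitCircleMeasure (-1)] with x hx hx'
  exact logMahlerMeasure_fiber_polyP α hx hx'

theorem logIntegrable_polyS (α : ℝ) : LogIntegrable (polyS α) :=
  logIntegrable_of_le_logMahlerMeasure_fiber (integrable_const 0) <|
    (ae_logMahlerMeasure_fiber_polyS α).mono fun _ hx => (quadMahler_nonneg _).trans_eq hx.symm

theorem logIntegrable_polyP (α : ℝ) : LogIntegrable (polyP α) :=
  logIntegrable_of_le_logMahlerMeasure_fiber integrable_log_norm_add_one <|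
    (ae_logMahlerMeasure_fiber_polyP α).mono fun _ hx =>
      (le_add_of_nonneg_right (quadMahler_nonneg _)).trans_eq hx.symm

theorem integrable_quadMahler_polyS (α : ℝ) :
    Integrable (fun x => quadMahler (offsetS x + slopeS x * α)) unitCircleMeasure :=
  (logIntegrable_polyS α).integrable_logMahlerMeasure_fiber.congr
    (ae_logMahlerMeasure_fiber_polyS α)

theorem integrable_quadMahler_polyP (α : ℝ) :
    Integrable (fun x => quadMahler (offsetP x + slopeP x * α)) unitCircleMeasure :=
  ((logIntegrable_polyP α).integrable_logMahlerMeasure_fiber.sub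
    integrable_log_norm_add_one).congr <| (ae_logMahlerMeasure_fiber_polyP α).mono fun x hx => by
      rw [Pi.sub_apply, hx, add_sub_cancel_left]

theorem logMahler_polyS (α : ℝ) :
    logMahler (polyS α) = ∫ x, quadMahler (offsetS x + slopeS x * α) ∂unitCircleMeasure := by
  rw [(logIntegrable_polyS α).logMahler_eq_integral_fiber,
    integral_congr_ae (ae_logMahlerMeasure_fiber_polyS α)]

theorem logMahler_polyP (α : ℝ) :
    logMahler (polyP α) = ∫ x, quadMahler (offsetP x + slopeP x * α) ∂unitCircleMeasure := by
  rw [(logIntegrable_polyP α).logMahler_eq_integral_fiber,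
    integral_congr_ae (ae_logMahlerMeasure_fiber_polyP α),
    integral_add integrable_log_norm_add_one (integrable_quadMahler_polyP α),
    integral_log_norm_add_one, zero_add]

/-- The derivative of `logMahler (polyS β)` in `β`, up to sign. -/
noncomputable def growthRateS (β : ℝ) : ℝ≥0∞ := growthRate unitCircleMeasure offsetS slopeS β

/-- The derivative of `logMahler (polyP β)` in `β`, up to sign. -/
noncomputable def growthRateP (β : ℝ) : ℝ≥0∞ := growthRate unitCircleMeasure offsetP slopeP β

theorem logMahler_polyS_eq_toReal (α : ℝ) :
    logMahler (polyS α) = (∫⁻ t in Ι 0 α, growthRateS t).toReal :=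
  (logMahler_polyS α).trans <| integral_quadMahler_affine measurable_offsetS measurable_slopeS
    ae_abs_offsetS_le ae_slopeS_pos α

theorem logMahler_polyP_eq_toReal (α : ℝ) :
    logMahler (polyP α) = (∫⁻ t in Ι 0 α, growthRateP t).toReal :=
  (logMahler_polyP α).trans <| integral_quadMahler_affine measurable_offsetP measurable_slopeP
    ae_abs_offsetP_le ae_slopeP_pos α

theorem logMahler_polyS_sub {α' α : ℝ} (hα' : α' ≤ α) (hα : α ≤ 0) :
    logMahler (polyS α') - logMahler (polyS α) = (∫⁻ t in Ioc α' α, growthRateS t).toReal := by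
  rw [logMahler_polyS, logMahler_polyS]
  exact integral_quadMahler_affine_sub measurable_offsetS measurable_slopeS ae_abs_offsetS_le
    ae_slopeS_pos hα' hα (integrable_quadMahler_polyS α')

theorem logMahler_polyP_sub {α' α : ℝ} (hα' : α' ≤ α) (hα : α ≤ 0) :
    logMahler (polyP α') - logMahler (polyP α) = (∫⁻ t in Ioc α' α, growthRateP t).toReal := by
  rw [logMahler_polyP, logMahler_polyP]
  exact integral_quadMahler_affine_sub measurable_offsetP measurable_slopeP ae_abs_offsetP_le
    ae_slopeP_pos hα' hα (integrable_quadMahler_polyP α')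

theorem tendsto_logMahler_polyS_sub_log :
    Tendsto (fun α => logMahler (polyS α) - Real.log (-α)) atBot (𝓝 0) := by
  have h := tendsto_integral_quadMahler_sub_log measurable_offsetS measurable_slopeS
    ae_abs_offsetS_le ae_slopeS_pos
    (by simpa only [log_slopeS] using integrable_log_norm_add_one.const_mul 2)
  simpa only [log_slopeS, integral_const_mul, integral_log_norm_add_one, mul_zero,
    ← logMahler_polyS] using h

theorem tendsto_logMahler_polyP_sub_log :
    Tendsto (fun α => logMahler (polyP α) - Real.log (-α)) atBot (𝓝 0) := by
  have h := tendsto_integral_quadMahler_sub_log measurable_offsetP measurable_slopeP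
    ae_abs_offsetP_le ae_slopeP_pos
    (by simp only [log_slopeP]; exact integrable_log_norm_add_one.neg)
  simpa only [log_slopeP, integral_neg, integral_log_norm_add_one, neg_zero,
    ← logMahler_polyP] using h

end MahlerMeasures

section EllipticIntegrals

/-- The integral of the differential `ds / √(F s)` over `t`, with the points where `F ≤ 0`
left out (they contribute `1 / 0 = 0`). -/
noncomputable def ellipticIntegral (F : ℝ → ℝ) (t : Set ℝ) : ℝ≥0∞ :=
  ∫⁻ s in t, ENNReal.ofReal (1 / √(F s))

theorem ellipticIntegral_of_subset_of_nonpos {F : ℝ → ℝ} {t u : Set ℝ} (ht : MeasurableSet t)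
    (hu : MeasurableSet u) (htu : t ⊆ u) (hF : ∀ s ∈ u \ t, F s ≤ 0) :
    ellipticIntegral F u = ellipticIntegral F t := by
  have hzero : ∫⁻ s in u \ t, ENNReal.ofReal (1 / √(F s)) = 0 :=
    setLIntegral_eq_zero (hu.diff ht) fun s hs => by simp [Real.sqrt_eq_zero_of_nonpos (hF s hs)]
  rw [ellipticIntegral, ← lintegral_inter_add_sdiff _ u ht, hzero, add_zero,
    inter_eq_right.mpr htu, ellipticIntegral]

theorem ellipticIntegral_Ioo_add_Ioo (F : ℝ → ℝ) {a b c : ℝ} (hab : a < b) (hbc : b ≤ c) :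
    ellipticIntegral F (Ioo a b) + ellipticIntegral F (Ioo b c) =
      ellipticIntegral F (Ioo a c) := by
  rw [ellipticIntegral, ellipticIntegral, ellipticIntegral, ← Ioo_union_Ico_eq_Ioo hab hbc,
    lintegral_union measurableSet_Ico (disjoint_left.mpr fun _ hx hx' => hx.2.not_ge hx'.1),
    setLIntegral_congr (Ioo_ae_eq_Ico (a := b))]

/-- The quartic whose elliptic integral is the growth rate of `logMahler (polyP β)`. -/
noncomputable def quarticP (β s : ℝ) : ℝ := s * (4 - s) * ((s - β) ^ 2 - 4 * s)

/-- The quartic whose elliptic integral is the growth rate of `logMahler (polyS β)`, in the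
variable `d = ‖x + 1‖ ^ 2 + β - 3`. -/
noncomputable def quarticS (β d : ℝ) : ℝ :=
  (1 + β - d) * (d - 1) * (d ^ 2 + (2 - β) * d + (1 + β))

theorem norm_circleMap_add_one_sq (θ : ℝ) : ‖circleMap 0 1 θ + 1‖ ^ 2 = 2 + 2 * Real.cos θ := by
  rw [← Complex.normSq_eq_norm_sq, Complex.normSq_apply]
  simp only [circleMap_zero, Complex.ofReal_one, one_mul, Complex.exp_ofReal_mul_I_re,
    Complex.exp_ofReal_mul_I_im, Complex.add_re, Complex.add_im, Complex.one_re, Complex.one_im]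
  linear_combination Real.sin_sq_add_cos_sq θ

theorem image_two_add_two_mul_cos : (fun θ => 2 + 2 * Real.cos θ) '' Ioo 0 π = Ioo 0 4 := by
  have h := ContinuousOn.image_Ioo_of_strictAntiOn (f := fun θ => 2 + 2 * Real.cos θ)
    Real.pi_pos.le (by fun_prop)
    fun θ hθ θ' hθ' h => by simpa using Real.strictAntiOn_cos hθ hθ' h
  norm_num at h
  exact h

theorem setLIntegral_comp_two_add_two_mul_cos (g : ℝ → ℝ≥0∞) :
    ∫⁻ θ in Ioc 0 π, g (2 + 2 * Real.cos θ) =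
      ∫⁻ s in Ioo 0 4, ENNReal.ofReal (1 / √(s * (4 - s))) * g s := by
  have hderiv : ∀ θ ∈ Ioo 0 π,
      HasDerivWithinAt (fun θ => 2 + 2 * Real.cos θ) (2 * -Real.sin θ) (Ioo 0 π) θ :=
    fun θ _ => (((Real.hasDerivAt_cos θ).const_mul 2).const_add 2).hasDerivWithinAt
  have hinj : InjOn (fun θ => 2 + 2 * Real.cos θ) (Ioo 0 π) := fun θ hθ θ' hθ' h =>
    Real.injOn_cos (Ioo_subset_Icc_self hθ) (Ioo_subset_Icc_self hθ') (by simpa using h)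
  rw [← image_two_add_two_mul_cos,
    lintegral_image_eq_lintegral_abs_deriv_mul measurableSet_Ioo hderiv hinj,
    setLIntegral_congr Ioo_ae_eq_Ioc.symm]
  refine setLIntegral_congr_fun measurableSet_Ioo fun θ hθ => ?_
  have hsin : 0 < 2 * Real.sin θ := mul_pos two_pos (Real.sin_pos_of_mem_Ioo hθ)
  have hweight : (2 + 2 * Real.cos θ) * (4 - (2 + 2 * Real.cos θ)) = (2 * Real.sin θ) ^ 2 := by
    linear_combination -4 * Real.sin_sq_add_cos_sq θ
  simp only [hweight, Real.sqrt_sq hsin.le, mul_neg, abs_neg, abs_of_pos hsin]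
  rw [← mul_assoc, ← ENNReal.ofReal_mul hsin.le, mul_one_div_cancel hsin.ne', ENNReal.ofReal_one,
    one_mul]

theorem setLIntegral_comp_cos_Ioc_pi_two_pi {g : ℝ → ℝ≥0∞} (hg : Measurable g) :
    ∫⁻ θ in Ioc π (2 * π), g (Real.cos θ) = ∫⁻ θ in Ioc 0 π, g (Real.cos θ) := by
  have h := (Measure.measurePreserving_sub_left volume (2 * π)).setLIntegral_comp_preimage
    (measurableSet_Ioc (a := π) (b := 2 * π)) (hg.comp Real.measurable_cos)
  simp only [Function.comp_apply, Real.cos_two_pi_sub, preimage_const_sub_Ioc, sub_self,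
    show 2 * π - π = π by ring] at h
  rw [← h]
  exact setLIntegral_congr Ico_ae_eq_Ioc

theorem lintegral_comp_norm_add_one_sq {g : ℝ → ℝ≥0∞} (hg : Measurable g) :
    ∫⁻ x : ℂ, g (‖x + 1‖ ^ 2) ∂unitCircleMeasure = (ENNReal.ofReal π)⁻¹ *
      ∫⁻ s in Ioo 0 4, ENNReal.ofReal (1 / √(s * (4 - s))) * g s := by
  rw [unitCircleMeasure, lintegral_smul_measure, lintegral_map (by fun_prop)
    measurable_unitCircleMap, ← Ioc_union_Ioc_eq_Ioc Real.pi_pos.le (by linarith [Real.pi_pos]),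
    lintegral_union measurableSet_Ioc (Ioc_disjoint_Ioc_of_le le_rfl)]
  simp only [norm_circleMap_add_one_sq]
  rw [setLIntegral_comp_cos_Ioc_pi_two_pi (g := fun c => g (2 + 2 * c)) (by fun_prop),
    setLIntegral_comp_two_add_two_mul_cos, ← two_mul, smul_eq_mul, ← mul_assoc,
    ENNReal.ofReal_mul zero_le_two, ENNReal.ofReal_ofNat,
    ENNReal.mul_inv (Or.inl two_ne_zero) (Or.inl ENNReal.ofNat_ne_top), mul_comm 2⁻¹,
    mul_assoc _ 2⁻¹, ENNReal.inv_mul_cancel two_ne_zero ENNReal.ofNat_ne_top, mul_one]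

theorem growthRateP_eq (β : ℝ) : growthRateP β =
    (ENNReal.ofReal π)⁻¹ * ellipticIntegral (quarticP β) (Ioo 0 4) := by
  have hmeas := measurable_quadKernel
  have h := lintegral_comp_norm_add_one_sq
    (g := fun s => ENNReal.ofReal (√s)⁻¹ * quadKernel (-√s + (√s)⁻¹ * β)) (by fun_prop)
  simp only [Real.sqrt_sq (norm_nonneg _)] at h
  refine h.trans (congrArg _ (setLIntegral_congr_fun measurableSet_Ioo fun s ⟨hs₀, hs₄⟩ => ?_))
  obtain ⟨r, hr, rfl⟩ : ∃ r, 0 < r ∧ r ^ 2 = s := ⟨√s, Real.sqrt_pos.mpr hs₀, Real.sq_sqrt hs₀.le⟩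
  have hfactor : quarticP β (r ^ 2) =
      r ^ 2 * (4 - r ^ 2) * (r ^ 2 * ((-r + r⁻¹ * β) ^ 2 - 4)) := by
    rw [quarticP]
    field_simp
    ring
  have hsqrt : √(quarticP β (r ^ 2)) =
      √(r ^ 2 * (4 - r ^ 2)) * (r * √((-r + r⁻¹ * β) ^ 2 - 4)) := by
    rw [hfactor, Real.sqrt_mul (by nlinarith), Real.sqrt_mul (sq_nonneg r) (_ - 4),
      Real.sqrt_sq hr.le]
  simp only [quadKernel, Real.sqrt_sq hr.le]
  rw [hsqrt, ← ENNReal.ofReal_mul (by positivity), ← ENNReal.ofReal_mul (by positivity)]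
  simp only [one_div, mul_inv]

theorem growthRateS_eq (β : ℝ) : growthRateS β =
    (ENNReal.ofReal π)⁻¹ * ellipticIntegral (quarticS β) (Ioo (β - 3) (1 + β)) := by
  have hmeas := measurable_quadKernel
  have hshift := (measurePreserving_add_right volume (β - 3)).setLIntegral_comp_preimage_emb
    (measurableEmbedding_addRight _) (fun d => ENNReal.ofReal (1 / √(quarticS β d)))
    (Ioo (β - 3) (1 + β))
  rw [preimage_add_const_Ioo, sub_self, show 1 + β - (β - 3) = 4 by ring] at hshift
  rw [ellipticIntegral, ← hshift]
  refine (lintegral_comp_norm_add_one_sq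
    (g := fun s => ENNReal.ofReal s * quadKernel ((s - 2) ^ 2 - 2 + s * β)) (by fun_prop)).trans
    (congrArg _ (setLIntegral_congr_fun measurableSet_Ioo fun s ⟨hs₀, hs₄⟩ => ?_))
  obtain ⟨r, hr, rfl⟩ : ∃ r, 0 < r ∧ r ^ 2 = s := ⟨√s, Real.sqrt_pos.mpr hs₀, Real.sq_sqrt hs₀.le⟩
  set K := (r ^ 2 + β - 4) * ((r ^ 2 - 2) ^ 2 + β * r ^ 2)
  have hfactorS : quarticS β (r ^ 2 + (β - 3)) = (4 - r ^ 2) * K := by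
    rw [quarticS]
    ring
  have hfactor : ((r ^ 2 - 2) ^ 2 - 2 + r ^ 2 * β) ^ 2 - 4 = r ^ 2 * K := by ring
  simp only [quadKernel]
  rw [hfactorS, hfactor, Real.sqrt_mul (sq_nonneg r), Real.sqrt_mul (sq_nonneg r),
    Real.sqrt_mul (sub_nonneg.mpr hs₄.le), Real.sqrt_sq hr.le, ← ENNReal.ofReal_mul hs₀.le,
    ← ENNReal.ofReal_mul (by positivity)]
  congr 1
  field_simp

end EllipticIntegrals

section Landen

/-- The substitution `s = 2 + β - d - (1 + β) / d`, which pulls `ds / √(quarticP β s)` back to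
`dd / √(quarticS β d)`. -/
noncomputable def landen (β d : ℝ) : ℝ := 2 + β - d - (1 + β) / d

theorem hasDerivAt_landen (β : ℝ) {d : ℝ} (hd : d ≠ 0) :
    HasDerivAt (landen β) ((1 + β) / d ^ 2 - 1) d := by
  have h := ((hasDerivAt_id d).const_sub (2 + β)).sub ((hasDerivAt_inv hd).const_mul (1 + β))
  exact h.congr_deriv (by ring)

theorem quarticP_landen (β : ℝ) {d : ℝ} (hd : d ≠ 0) :
    quarticP β (landen β d) = ((1 + β) / d ^ 2 - 1) ^ 2 * quarticS β d := by
  rw [quarticP, quarticS, landen]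
  field_simp
  ring

theorem ellipticIntegral_quarticP_image_landen (β : ℝ) {t : Set ℝ} (ht : MeasurableSet t)
    (hinj : InjOn (landen β) t) (ht0 : ∀ d ∈ t, d ≠ 0) (ht' : ∀ d ∈ t, (1 + β) / d ^ 2 - 1 ≠ 0) :
    ellipticIntegral (quarticP β) (landen β '' t) = ellipticIntegral (quarticS β) t := by
  rw [ellipticIntegral, lintegral_image_eq_lintegral_abs_deriv_mul ht
    (fun d hd => (hasDerivAt_landen β (ht0 d hd)).hasDerivWithinAt) hinj]
  refine setLIntegral_congr_fun ht fun d hd => ?_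
  simp only [quarticP_landen β (ht0 d hd), Real.sqrt_mul (sq_nonneg _), Real.sqrt_sq_eq_abs]
  rw [← ENNReal.ofReal_mul (abs_nonneg _), ← div_div, ← mul_div_assoc,
    mul_one_div_cancel (abs_ne_zero.mpr (ht' d hd))]

theorem landen_sub_landen (β : ℝ) {d e : ℝ} (hd : d ≠ 0) (he : e ≠ 0) :
    landen β e - landen β d = (e - d) * ((1 + β) / (d * e) - 1) := by
  rw [landen, landen]
  field_simp
  ring

theorem landen_one_add {β : ℝ} (hβ : 1 + β ≠ 0) : landen β (1 + β) = 0 := by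
  rw [landen, div_self hβ]
  ring

theorem strictMonoOn_landen {β a : ℝ} (haβ : a ^ 2 = 1 + β) :
    StrictMonoOn (landen β) (Ioc 0 a) := by
  intro d hd e he hde
  have hmul : 0 < d * e := mul_pos hd.1 he.1
  have hlt : 1 < (1 + β) / (d * e) := by
    rw [one_lt_div hmul, ← haβ]
    nlinarith [hd.1, he.2]
  rw [← sub_pos, landen_sub_landen β hd.1.ne' he.1.ne']
  exact mul_pos (sub_pos.mpr hde) (sub_pos.mpr hlt)

theorem strictAntiOn_landen {β a : ℝ} (ha : 0 < a) (haβ : a ^ 2 = 1 + β) :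
    StrictAntiOn (landen β) (Ici a) := by
  intro d hd e _ hde
  have hd0 : 0 < d := ha.trans_le hd
  have hlt : (1 + β) / (d * e) < 1 := by
    rw [div_lt_one (mul_pos hd0 (hd0.trans hde)), ← haβ]
    nlinarith [mem_Ici.mp hd]
  rw [← sub_neg, landen_sub_landen β hd0.ne' (hd0.trans hde).ne']
  exact mul_neg_of_pos_of_neg (sub_pos.mpr hde) (sub_neg.mpr hlt)

theorem strictAntiOn_landen_Iio {β : ℝ} (hβ : β ≤ -1) : StrictAntiOn (landen β) (Iio 0) := by
  intro d hd e he hde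
  have hlt : (1 + β) / (d * e) < 1 :=
    (div_nonpos_of_nonpos_of_nonneg (by linarith) (mul_pos_of_neg_of_neg hd he).le).trans_lt
      one_pos
  rw [← sub_neg, landen_sub_landen β (ne_of_lt hd) (ne_of_lt he)]
  exact mul_neg_of_pos_of_neg (sub_pos.mpr hde) (sub_neg.mpr hlt)

theorem continuousOn_landen (β : ℝ) {t : Set ℝ} (ht0 : ∀ d ∈ t, d ≠ 0) :
    ContinuousOn (landen β) t :=
  fun d hd => (hasDerivAt_landen β (ht0 d hd)).continuousAt.continuousWithinAt

theorem landen_of_sq_eq {β a : ℝ} (haβ : a ^ 2 = 1 + β) : landen β a = (a - 1) ^ 2 := by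
  rw [landen, ← haβ, sq a, mul_self_div_self]
  linear_combination -haβ

theorem ellipticIntegral_quarticS_Ioo_one {β a : ℝ} (ha : 1 < a) (haβ : a ^ 2 = 1 + β) :
    ellipticIntegral (quarticS β) (Ioo 1 a) =
      ellipticIntegral (quarticP β) (Ioo 0 ((a - 1) ^ 2)) := by
  have hmono : StrictMonoOn (landen β) (Icc 1 a) :=
    (strictMonoOn_landen haβ).mono fun d hd => ⟨one_pos.trans_le hd.1, hd.2⟩
  have himage := ContinuousOn.image_Ioo_of_strictMonoOn ha.le
    (continuousOn_landen β fun d hd => (one_pos.trans_le hd.1).ne') hmono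
  rw [landen_of_sq_eq haβ, show landen β 1 = 0 by rw [landen]; ring] at himage
  rw [← himage, ellipticIntegral_quarticP_image_landen β measurableSet_Ioo
    (hmono.injOn.mono Ioo_subset_Icc_self) fun d hd => (one_pos.trans hd.1).ne']
  intro d hd
  have hd0 : 0 < d := one_pos.trans hd.1
  have : d ^ 2 < 1 + β := by nlinarith [hd.2]
  exact (sub_pos.mpr ((one_lt_div (pow_pos hd0 2)).mpr this)).ne'

theorem ellipticIntegral_quarticS_Ioo_sq {β a : ℝ} (ha : 1 < a) (haβ : a ^ 2 = 1 + β) :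
    ellipticIntegral (quarticS β) (Ioo a (1 + β)) =
      ellipticIntegral (quarticP β) (Ioo 0 ((a - 1) ^ 2)) := by
  have ha0 : 0 < a := one_pos.trans ha
  have hanti : StrictAntiOn (landen β) (Icc a (1 + β)) :=
    (strictAntiOn_landen ha0 haβ).mono Icc_subset_Ici_self
  have himage := ContinuousOn.image_Ioo_of_strictAntiOn (by nlinarith)
    (continuousOn_landen β fun d hd => (ha0.trans_le hd.1).ne') hanti
  rw [landen_of_sq_eq haβ, landen_one_add (haβ ▸ (pow_pos ha0 2).ne')] at himage
  rw [← himage, ellipticIntegral_quarticP_image_landen β measurableSet_Ioo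
    (hanti.injOn.mono Ioo_subset_Icc_self) fun d hd => (ha0.trans hd.1).ne']
  intro d hd
  have : 1 + β < d ^ 2 := by nlinarith [hd.1]
  exact (sub_neg.mpr ((div_lt_one (pow_pos (ha0.trans hd.1) 2)).mpr this)).ne

theorem ellipticIntegral_quarticS_Ioo_of_lt_neg_one {β d₀ : ℝ} (hβ : β < -1)
    (hd₀ : d₀ < 1 + β) (hroot : d₀ ^ 2 + (2 - β) * d₀ + (1 + β) = 0) :
    ellipticIntegral (quarticS β) (Ioo d₀ (1 + β)) =
      ellipticIntegral (quarticP β) (Ioo 0 4) := by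
  have hneg : ∀ d ≤ 1 + β, d < 0 := fun d hd => by linarith
  have hanti : StrictAntiOn (landen β) (Icc d₀ (1 + β)) :=
    (strictAntiOn_landen_Iio hβ.le).mono fun d hd => hneg d hd.2
  have himage := ContinuousOn.image_Ioo_of_strictAntiOn hd₀.le
    (continuousOn_landen β fun d hd => (hneg d hd.2).ne) hanti
  have hfour : landen β d₀ = 4 := by
    have hd₀0 := (hneg d₀ hd₀.le).ne
    rw [landen]
    field_simp
    linear_combination -hroot
  rw [hfour, landen_one_add (hneg _ le_rfl).ne] at himage
  rw [← himage, ellipticIntegral_quarticP_image_landen β measurableSet_Ioo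
    (hanti.injOn.mono Ioo_subset_Icc_self) fun d hd => (hneg d hd.2.le).ne]
  intro d _
  have : (1 + β) / d ^ 2 ≤ 0 := div_nonpos_of_nonpos_of_nonneg (by linarith) (sq_nonneg d)
  linarith

end Landen

section GrowthRates

theorem growthRateS_eq_two_mul {β : ℝ} (hβ₀ : 0 < β) (hβ₄ : β < 4) :
    growthRateS β = 2 * growthRateP β := by
  obtain ⟨a, ha, haβ⟩ : ∃ a, 1 < a ∧ a ^ 2 = 1 + β :=
    ⟨√(1 + β), Real.lt_sqrt_of_sq_lt (by linarith), Real.sq_sqrt (by linarith)⟩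
  have hP : ellipticIntegral (quarticP β) (Ioo 0 4) =
      ellipticIntegral (quarticP β) (Ioo 0 ((a - 1) ^ 2)) := by
    refine ellipticIntegral_of_subset_of_nonpos measurableSet_Ioo measurableSet_Ioo
      (Ioo_subset_Ioo_right (by nlinarith)) fun s ⟨⟨hs₀, hs₄⟩, hs⟩ => ?_
    have hs' : (a - 1) ^ 2 ≤ s := not_lt.mp fun h => hs ⟨hs₀, h⟩
    have hfactor : (s - β) ^ 2 - 4 * s = (s - (a - 1) ^ 2) * (s - (a + 1) ^ 2) := by
      rw [show β = a ^ 2 - 1 by linarith]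
      ring
    rw [quarticP, hfactor]
    refine mul_nonpos_of_nonneg_of_nonpos (by nlinarith) ?_
    exact mul_nonpos_of_nonneg_of_nonpos (sub_nonneg.mpr hs') (by nlinarith)
  have hS : ellipticIntegral (quarticS β) (Ioo (β - 3) (1 + β)) =
      ellipticIntegral (quarticS β) (Ioo 1 (1 + β)) := by
    refine ellipticIntegral_of_subset_of_nonpos measurableSet_Ioo measurableSet_Ioo
      (Ioo_subset_Ioo_left (by linarith)) fun d ⟨⟨_, hd⟩, hd'⟩ => ?_
    have hd₁ : d ≤ 1 := not_lt.mp fun h => hd' ⟨h, hd⟩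
    rw [quarticS]
    refine mul_nonpos_of_nonpos_of_nonneg ?_ (by nlinarith [sq_nonneg (2 * d + (2 - β))])
    exact mul_nonpos_of_nonneg_of_nonpos (by linarith) (by linarith)
  rw [growthRateS_eq, growthRateP_eq, hP, hS,
    ← ellipticIntegral_Ioo_add_Ioo _ ha (by nlinarith : a ≤ 1 + β),
    ellipticIntegral_quarticS_Ioo_one ha haβ, ellipticIntegral_quarticS_Ioo_sq ha haβ, ← two_mul,
    mul_left_comm]

theorem growthRateS_eq_growthRateP {β : ℝ} (hβ : β < -1) : growthRateS β = growthRateP β := by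
  obtain ⟨d₀, hd₀, hroot⟩ : ∃ d₀ ∈ Ioo (β - 3) (1 + β),
      d₀ ^ 2 + (2 - β) * d₀ + (1 + β) = 0 :=
    intermediate_value_Ioo' (f := fun d => d ^ 2 + (2 - β) * d + (1 + β)) (by linarith)
      (by fun_prop) ⟨by nlinarith, by nlinarith⟩
  have hS : ellipticIntegral (quarticS β) (Ioo (β - 3) (1 + β)) =
      ellipticIntegral (quarticS β) (Ioo d₀ (1 + β)) := by
    refine ellipticIntegral_of_subset_of_nonpos measurableSet_Ioo measurableSet_Ioo
      (Ioo_subset_Ioo_left hd₀.1.le) fun d ⟨⟨_, hd⟩, hd'⟩ => ?_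
    have hdd₀ : d ≤ d₀ := not_lt.mp fun h => hd' ⟨h, hd⟩
    -- The roots of the quadratic factor have the product `1 + β < 0`, so `d₀` is the smaller one.
    have hfactor : d₀ * (d ^ 2 + (2 - β) * d + (1 + β)) = (d - d₀) * (d₀ * d - (1 + β)) := by
      linear_combination d * hroot
    have hquad : 0 ≤ d ^ 2 + (2 - β) * d + (1 + β) := by
      refine nonneg_of_mul_nonpos_right ?_ (show d₀ < 0 by linarith [hd₀.2])
      rw [hfactor]
      exact mul_nonpos_of_nonpos_of_nonneg (by linarith) (by nlinarith [hd₀.2])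
    rw [quarticS]
    exact mul_nonpos_of_nonpos_of_nonneg
      (mul_nonpos_of_nonneg_of_nonpos (by linarith) (by linarith)) hquad
  rw [growthRateS_eq, growthRateP_eq, hS,
    ellipticIntegral_quarticS_Ioo_of_lt_neg_one hβ hd₀.2 hroot]

theorem logMahler_polyS_eq_two_mul {α : ℝ} (hα₀ : 0 ≤ α) (hα₄ : α ≤ 4) :
    logMahler (polyS α) = 2 * logMahler (polyP α) := by
  have hrate : ∫⁻ t in Ι 0 α, growthRateS t = 2 * ∫⁻ t in Ι 0 α, growthRateP t := by
    rw [uIoc_of_le hα₀, setLIntegral_congr Ioo_ae_eq_Ioc.symm,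
      setLIntegral_congr Ioo_ae_eq_Ioc.symm, ← lintegral_const_mul' _ _ ENNReal.ofNat_ne_top]
    exact setLIntegral_congr_fun measurableSet_Ioo fun t ht =>
      growthRateS_eq_two_mul ht.1 (ht.2.trans_le hα₄)
  rw [logMahler_polyS_eq_toReal, logMahler_polyP_eq_toReal, hrate, ENNReal.toReal_mul,
    ENNReal.toReal_ofNat]

theorem logMahler_polyS_sub_eq {α' α : ℝ} (hα' : α' ≤ α) (hα : α ≤ -1) :
    logMahler (polyS α') - logMahler (polyS α) = logMahler (polyP α') - logMahler (polyP α) := by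
  rw [logMahler_polyS_sub hα' (by linarith), logMahler_polyP_sub hα' (by linarith),
    setLIntegral_congr Ioo_ae_eq_Ioc.symm, setLIntegral_congr Ioo_ae_eq_Ioc.symm]
  exact congrArg _ <| setLIntegral_congr_fun measurableSet_Ioo fun t ht =>
    growthRateS_eq_growthRateP (ht.2.trans_le hα)

theorem logMahler_polyS_eq {α : ℝ} (hα : α ≤ -1) :
    logMahler (polyS α) = logMahler (polyP α) := by
  have hlim : Tendsto (fun α' => logMahler (polyS α') - logMahler (polyP α')) atBot (𝓝 0) := by
    simpa only [sub_sub_sub_cancel_right, sub_zero] using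
      tendsto_logMahler_polyS_sub_log.sub tendsto_logMahler_polyP_sub_log
  have hconst : ∀ᶠ α' in atBot, logMahler (polyS α) - logMahler (polyP α) =
      logMahler (polyS α') - logMahler (polyP α') := by
    filter_upwards [eventually_le_atBot α] with α' hα'
    linarith [logMahler_polyS_sub_eq hα' hα]
  exact sub_eq_zero.mp (tendsto_nhds_unique (tendsto_const_nhds.congr' hconst) hlim)

end GrowthRates

end MahlerFamilies

theorem theorem1p1 (α : ℝ) :
    MahlerFamilies.LogIntegrable (MahlerFamilies.polyP α) ∧
    MahlerFamilies.LogIntegrable (MahlerFamilies.polyS α) ∧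
    (0 ≤ α → α ≤ 4 →
      MahlerFamilies.logMahler (MahlerFamilies.polyS α) =
        2 * MahlerFamilies.logMahler (MahlerFamilies.polyP α)) ∧
    (α ≤ -1 →
      MahlerFamilies.logMahler (MahlerFamilies.polyS α) =
        MahlerFamilies.logMahler (MahlerFamilies.polyP α)) := by
  exact ⟨MahlerFamilies.logIntegrable_polyP α, MahlerFamilies.logIntegrable_polyS α,
    MahlerFamilies.logMahler_polyS_eq_two_mul, MahlerFamilies.logMahler_polyS_eq⟩
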